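/- Let $k$ be a field of characteristic $0$ and let $\mathcal C$ be a $k$-linear abelian braided monoidal category whose tensor product is $k$-linear and right exact in each variable, satisfying the following two conditions. (PF) $\mathcal C$ has a projective generator with finite-dimensional endomorphism space. Here a projective generator is a projective object $P$ such that every object is a quotient of $P^{\oplus m}$ for some $m\in\mathbb N$. (C) $\mathcal C$ is equipped with a contravariant $k$-linear functor $(-)^*:\mathcal C\to\mathcal C$, natural isomorphisms $\delta_U:U\to U^{**}$ with $(\delta_U)^*=(\delta_{U^*})^{-1}$, and linear isomorphisms $\pi_{U,V}:\mathcal C(U,V^*)\to\mathcal C(U\otimes V,\mathbf 1^*)$ natural in $U$ and $V$. Put $\beta_U:=\pi_{U,U^*}(\delta_U):U\otimes U^*\to\mathbf 1^*$. Let $(\mathcal C^2,\boxtimes)$, $\mathcal C^2=\mathcal C\boxtimes\mathcal C^{\mathrm{rev}}$, be the Deligne product: $\mathcal C^2$ is a $k$-linear abelian category, $\boxtimes:\mathcal C\times\mathcal C\to\mathcal C^2$ is $k$-linear and right exact in each variable, and for every $k$-linear abelian category $\mathcal B$, composition with $\boxtimes$ is an equivalence from the category of $k$-linear right exact functors $\mathcal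 C^2\to\mathcal B$ to the category of functors $\mathcal C\times\mathcal C\to\mathcal B$ that are $k$-linear and right exact in each variable. (As an underlying category $\mathcal C\boxtimes\mathcal C^{\mathrm{rev}}$ is $\mathcal C\boxtimes\mathcal C$; "rev" only refers to the braiding.) Let $T:\mathcal C^2\to\mathcal C$ be the $k$-linear right exact functor induced by the tensor product, with its natural isomorphism $T(U\boxtimes V)\cong U\otimes V$, which is suppressed from the notation. Let $P$ be any projective generator of $\mathcal C$ and let $N\subset\mathcal C^2(P\boxtimes P,P\boxtimes P^*)$ be the linear subspace of all $f$ with $\beta_P\circ T(f)=0$. Then: (1) $N$ is finite-dimensional. (2) Let $u_1,\dots,u_{|N|}$ be any basis of $N$ (so $|N|=\dim_k N$), let $n=\sum_i u_i\circ\pi_i:(P\boxtimes P)^{\oplus|N|}\to P\boxtimes P^*$, with $\pi_i$ the projection to the $i$-th summand, and let $R'=\operatorname{cok}(n)$. There is a unique morphism $r':T(R')\to\mathbf 1^*$ with $r'\circ T(\operatorname{cok}(n))=\beta_P$, and $R'$ represents the functor $\mathcal C(T(-),\mathbf 1^*)$: there is an isomorphism of $k$-vector spaces $\chi_X:\mathcal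 C(T(X),\mathbf 1^*)\to\mathcal C^2(X,R')$, natural in $X\in\mathcal C^2$, and it can be chosen such that $\chi_{R'}(r')=\mathrm{id}_{R'}$. (3) In particular, a representing object $R_{\mathbf 1^*}$ of the functor $\mathcal C(T(-),\mathbf 1^*)$ from $\mathcal C^2$ to $k$-vector spaces exists. -/

import Mathlib

open CategoryTheory CategoryTheory.Limits CategoryTheory.MonoidalCategory Opposite

universe w v u u' t

section LinearAbelian

variable (k : Type w) [Field k]

/-- A `k`-linear right exact functor between `k`-linear abelian categories. -/
structure IsLinearRightExact {A : Type u} [Category.{v} A] [Abelian A] [Linear k A]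
    {B : Type u'} [Category.{v} B] [Abelian B] [Linear k B] (F : A ⥤ B) : Prop where
  additive : F.Additive
  linear : F.Linear k
  rightExact : PreservesFiniteColimits F

/-- A functor of two variables which is `k`-linear and right exact in each variable. -/
structure IsBilinearRightExact {A : Type u} [Category.{v} A] [Abelian A] [Linear k A]
    {A' : Type u'} [Category.{v} A'] [Abelian A'] [Linear k A']
    {B : Type t} [Category.{v} B] [Abelian B] [Linear k B] (F : A ⥤ A' ⥤ B) : Prop where
  left : ∀ Y : A', IsLinearRightExact k (F.flip.obj Y)
  right : ∀ X : A, IsLinearRightExact k (F.obj X)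

/-- The category of `k`-linear right exact functors `A ⥤ B`, with all natural transformations. -/
abbrev LinRexFunctor (A : Type u) [Category.{v} A] [Abelian A] [Linear k A]
    (B : Type u') [Category.{v} B] [Abelian B] [Linear k B] :=
  ObjectProperty.FullSubcategory (fun F : A ⥤ B => IsLinearRightExact k F)

/-- The category of functors of two variables, `k`-linear and right exact in each variable,
with all natural transformations. -/
abbrev BilinRexFunctor (A : Type u) [Category.{v} A] [Abelian A] [Linear k A]
    (A' : Type u') [Category.{v} A'] [Abelian A'] [Linear k A']
    (B : Type t) [Category.{v} B] [Abelian B] [Linear k B] :=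
  ObjectProperty.FullSubcategory (fun F : A ⥤ A' ⥤ B => IsBilinearRightExact k F)

end LinearAbelian

section DeligneProduct

variable (k : Type w) [Field k]

/-- Post-composing a functor which is linear right exact in each variable with a
linear right exact functor. -/
theorem IsBilinearRightExact.comp
    {A : Type u} [Category.{v} A] [Abelian A] [Linear k A]
    {D : Type u'} [Category.{v} D] [Abelian D] [Linear k D]
    {B : Type t} [Category.{v} B] [Abelian B] [Linear k B]
    {box : A ⥤ A ⥤ D} (hbox : IsBilinearRightExact k box)
    {F : D ⥤ B} (hF : IsLinearRightExact k F) :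
    IsBilinearRightExact k ((Functor.postcompose₂.obj F).obj box) := by
  obtain ⟨h1, h2, h3⟩ := hF
  constructor
  · intro Y
    obtain ⟨g1, g2, g3⟩ := hbox.left Y
    exact ⟨inferInstanceAs (box.flip.obj Y ⋙ F).Additive,
      inferInstanceAs ((box.flip.obj Y ⋙ F).Linear k),
      inferInstanceAs (PreservesFiniteColimits (box.flip.obj Y ⋙ F))⟩
  · intro X
    obtain ⟨g1, g2, g3⟩ := hbox.right X
    exact ⟨inferInstanceAs (box.obj X ⋙ F).Additive,
      inferInstanceAs ((box.obj X ⋙ F).Linear k),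
      inferInstanceAs (PreservesFiniteColimits (box.obj X ⋙ F))⟩

/-- The functor `F ↦ F ∘ ⊠` from linear right exact functors on `D` to functors of two
variables on `A` that are linear right exact in each variable. -/
def restrictAlong
    {A : Type u} [Category.{v} A] [Abelian A] [Linear k A]
    {D : Type u'} [Category.{v} D] [Abelian D] [Linear k D]
    {box : A ⥤ A ⥤ D} (hbox : IsBilinearRightExact k box)
    (B : Type t) [Category.{v} B] [Abelian B] [Linear k B] :
    LinRexFunctor k D B ⥤ BilinRexFunctor k A A B :=
  ObjectProperty.lift _
    (ObjectProperty.ι _ ⋙ Functor.postcompose₂.flip.obj box)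
    (fun F => hbox.comp k F.property)

/-- `(D, ⊠)` is a Deligne product of the `k`-linear abelian category `A` with itself: `⊠` is
`k`-linear and right exact in each variable, and for every `k`-linear abelian category `B`,
composition with `⊠` is an equivalence from the category of `k`-linear right exact functors
`D ⥤ B` to the category of functors from `A × A` (in curried form) to `B` that are `k`-linear
and right exact in each variable.  The universe `t` bounds the size of the test categories. -/
structure IsDeligneSquare
    {A : Type u} [Category.{v} A] [Abelian A] [Linear k A]
    {D : Type u'} [Category.{v} D] [Abelian D] [Linear k D] (box : A ⥤ A ⥤ D) : Prop where
  bilinear : IsBilinearRightExact k box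
  universal : ∀ (B : Type t) [Category.{v} B] [Abelian B] [Linear k B],
    (restrictAlong k bilinear B).IsEquivalence

end DeligneProduct

section Finiteness

instance hasFiniteBiproductsOfAbelian {A : Type u} [Category.{v} A] [Abelian A] :
    HasFiniteBiproducts A :=
  Abelian.hasFiniteBiproducts

/-- `P` is projective and every object is a quotient of a finite direct sum of copies of `P`. -/
structure IsProjectiveGenerator {A : Type u} [Category.{v} A] [Abelian A] (P : A) : Prop where
  projective : Projective P
  generates : ∀ U : A, ∃ (m : ℕ) (s : (⨁ fun _ : Fin m => P) ⟶ U), Epi s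

/-- The finiteness condition (PF): there is a projective generator with finite-dimensional
endomorphism space. -/
def SatisfiesPF (k : Type w) [Field k] (A : Type u) [Category.{v} A] [Abelian A] [Linear k A] :
    Prop :=
  ∃ P : A, IsProjectiveGenerator P ∧ FiniteDimensional k (P ⟶ P)

end Finiteness

section Conjugates

/-- Conjugates on a `k`-linear monoidal category: an involutive contravariant `k`-linear functor
`U ↦ U^*` with natural isomorphisms `δ_U : U ≅ U^**` satisfying `(δ_U)^* = (δ_{U^*})⁻¹`, and
isomorphisms `π_{U,V} : Hom(U, V^*) ≅ Hom(U ⊗ V, 𝟙^*)` natural in `U` and `V`. -/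
structure Conjugates (k : Type w) [Field k] (C : Type u) [Category.{v} C] [Abelian C]
    [Linear k C] [MonoidalCategory C] where
  star : Cᵒᵖ ⥤ C
  star_add : ∀ {U V : C} (f g : U ⟶ V), star.map (f + g).op = star.map f.op + star.map g.op
  star_smul : ∀ {U V : C} (a : k) (f : U ⟶ V), star.map (a • f).op = a • star.map f.op
  δ : 𝟭 C ≅ star.rightOp ⋙ star
  star_δ : ∀ U : C, star.map (δ.hom.app U).op = δ.inv.app (star.obj (op U))
  π : ∀ U V : C, (U ⟶ star.obj (op V)) ≃ₗ[k] (U ⊗ V ⟶ star.obj (op (𝟙_ C)))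
  π_natural_left : ∀ {X U : C} (V : C) (a : X ⟶ U) (q : U ⟶ star.obj (op V)),
    π X V (a ≫ q) = (a ▷ V) ≫ π U V q
  π_natural_right : ∀ (U : C) {Y V : C} (b : Y ⟶ V) (q : U ⟶ star.obj (op V)),
    π U Y (q ≫ star.map b.op) = (U ◁ b) ≫ π U V q

namespace Conjugates

variable {k : Type w} [Field k] {C : Type u} [Category.{v} C] [Abelian C]
  [Linear k C] [MonoidalCategory C] (c : Conjugates k C)

/-- The conjugate object `U^*`. -/
abbrev conj (U : C) : C := c.star.obj (op U)

/-- The canonical non-degenerate pairing `β_U = π_{U,U^*}(δ_U) : U ⊗ U^* ⟶ 𝟙^*`. -/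
def pairing (U : C) : U ⊗ c.conj U ⟶ c.conj (𝟙_ C) :=
  c.π U (c.conj U) (c.δ.hom.app U)

end Conjugates

end Conjugates

section Construction

variable {k : Type w} [Field k] {C : Type u} [Category.{v} C] [Abelian C]
  [Linear k C] [MonoidalCategory C] (c : Conjugates k C)
  {D : Type u'} [Category.{v} D] [Abelian D] [Linear k D] {box : C ⥤ C ⥤ D}
  {T : D ⥤ C} (hT : IsLinearRightExact k T)
  (τ : (Functor.postcompose₂.obj T).obj box ≅ curriedTensor C)

/-- The component `T(U ⊠ V) ≅ U ⊗ V` of an isomorphism `τ : T ∘ ⊠ ≅ ⊗`. -/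
def boxTensorIso (U V : C) : T.obj ((box.obj U).obj V) ≅ U ⊗ V :=
  (τ.app U).app V

/-- The subspace `N` of `Hom(P ⊠ P, P ⊠ P^*)` of all `f` with `β_P ∘ T(f) = 0`, where
`T(P ⊠ Q)` is identified with `P ⊗ Q`. -/
def relationSpace (P : C) :
    Submodule k ((box.obj P).obj P ⟶ (box.obj P).obj (c.conj P)) where
  carrier := {f | (boxTensorIso τ P P).inv ≫ T.map f ≫
    (boxTensorIso τ P (c.conj P)).hom ≫ c.pairing P = 0}
  zero_mem' := by
    have := hT.additive
    simp
  add_mem' := by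
    have := hT.additive
    intro f g hf hg
    change _ ≫ T.map f ≫ _ ≫ _ = 0 at hf
    change _ ≫ T.map g ≫ _ ≫ _ = 0 at hg
    change _ ≫ T.map (f + g) ≫ _ ≫ _ = 0
    rw [T.map_add, Preadditive.add_comp, Preadditive.comp_add, hf, hg, add_zero]
  smul_mem' := by
    have := hT.linear
    intro a f hf
    change _ ≫ T.map f ≫ _ ≫ _ = 0 at hf
    change _ ≫ T.map (a • f) ≫ _ ≫ _ = 0
    rw [T.map_smul, Linear.smul_comp, Linear.comp_smul, hf, smul_zero]

/-- The map `n = ∑ᵢ uᵢ ∘ πᵢ : (P ⊠ P)^{⊕ r} ⟶ P ⊠ P^*` built from a basis `u₁, …, u_r`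
of `N`. -/
noncomputable def relationMap (P : C) {r : ℕ}
    (b : Module.Basis (Fin r) k (relationSpace c hT τ P)) :
    (⨁ fun _ : Fin r => (box.obj P).obj P) ⟶ (box.obj P).obj (c.conj P) :=
  ∑ i : Fin r, biproduct.π (fun _ : Fin r => (box.obj P).obj P) i ≫
    (b i : (box.obj P).obj P ⟶ (box.obj P).obj (c.conj P))

end Construction

/-!
By the universal property, a natural map from a linear right exact functor on `C ⊠ C` is determined
by its components at the objects `X ⊠ Y`, and any compatible family of such components extends.
Comparing with the functors `Hom(-, W)`, which are right exact with values in the opposite of a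
module category, shows that a morphism `r : T R ⟶ W` represents `Hom(T -, W)` by `R` as soon as
`f ↦ T f ≫ r` is bijective on `Hom(Q, R)`, where `Q = P ⊠ P`.

The functor `(X, Y) ↦ Hom(P, X) ⊗ Hom(P, Y)` extends to a right exact functor on `C ⊠ C` which maps
onto `Hom(Q, -)`, because the identity of `Q` is in the image. Hence `Q` is projective, and
`Hom(Q, X ⊠ Y)` is finite-dimensional.

For `R = R'` bijectivity on `Hom(Q, R')` is then elementary. A morphism `Q ⟶ R'` lifts to `P ⊠ P^*`;
if it is killed, the lift lies in `N` and factors through `n`. Every morphism `P ⊗ P ⟶ 𝟙^*` has the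
form `(P ◁ b) ≫ β_P`, by naturality of `π` and `δ`.
-/

section Generator

theorem isIso_app_of_generates {A : Type*} [Category* A] [Abelian A] {B : Type*} [Category* B]
    [Abelian B] {F F' : A ⥤ B}
    [PreservesFiniteColimits F] [PreservesFiniteColimits F'] (α : F ⟶ F') {P : A}
    (hP : ∀ U : A, ∃ (m : ℕ) (s : (⨁ fun _ : Fin m => P) ⟶ U), Epi s)
    [IsIso (α.app P)] (X : A) : IsIso (α.app X) := by
  have isIso_biproduct (m : ℕ) : IsIso (α.app (⨁ fun _ : Fin m => P)) := by
    have : IsIso (Functor.whiskerLeft (Discrete.functor fun _ : Fin m => P) α) :=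
      have (i : Discrete (Fin m)) :
          IsIso ((Functor.whiskerLeft (Discrete.functor fun _ : Fin m => P) α).app i) :=
        inferInstanceAs (IsIso (α.app P))
      NatIso.isIso_of_isIso_app _
    exact isIso_app_coconePt_of_preservesColimit _ α _ (biproduct.isColimit _)
  obtain ⟨m, s, hs⟩ := hP X
  obtain ⟨n, q, hq⟩ := hP (kernel s)
  have : IsIso (Functor.whiskerLeft (parallelPair (q ≫ kernel.ι s) 0) α) :=
    have (j : WalkingParallelPair) :
        IsIso ((Functor.whiskerLeft (parallelPair (q ≫ kernel.ι s) 0) α).app j) := by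
      rcases j with _ | _
      exacts [isIso_biproduct n, isIso_biproduct m]
    NatIso.isIso_of_isIso_app _
  exact isIso_app_coconePt_of_preservesColimit (parallelPair (q ≫ kernel.ι s) 0) α _
    (isCokernelEpiComp (Abelian.epiIsCokernelOfKernel _ (kernelIsKernel s)) q rfl)

end Generator

section Deligne

instance linearOpposite {R : Type*} [Semiring R] {A : Type*} [Category* A] [Preadditive A]
    [Linear R A] : Linear R Aᵒᵖ where
  homModule _ _ :=
    { smul a f := (a • f.unop).op
      one_smul f := congrArg Quiver.Hom.op (one_smul R f.unop)
      mul_smul a b f := congrArg Quiver.Hom.op (mul_smul a b f.unop)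
      smul_zero a := congrArg Quiver.Hom.op (smul_zero a)
      smul_add a f g := congrArg Quiver.Hom.op (smul_add a f.unop g.unop)
      add_smul a b f := congrArg Quiver.Hom.op (add_smul a b f.unop)
      zero_smul f := congrArg Quiver.Hom.op (zero_smul R f.unop) }
  smul_comp _ _ _ a f g := congrArg Quiver.Hom.op (Linear.comp_smul _ _ _ g.unop a f.unop)
  comp_smul _ _ _ f a g := congrArg Quiver.Hom.op (Linear.smul_comp _ _ _ a g.unop f.unop)

variable {k : Type w} [Field k]

theorem IsLinearRightExact.comp {A : Type u} [Category.{v} A] [Abelian A] [Linear k A]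
    {B : Type u'} [Category.{v} B] [Abelian B] [Linear k B]
    {B' : Type t} [Category.{v} B'] [Abelian B'] [Linear k B']
    {F : A ⥤ B} {F' : B ⥤ B'}
    (hF : IsLinearRightExact k F) (hF' : IsLinearRightExact k F') :
    IsLinearRightExact k (F ⋙ F') := by
  obtain ⟨_, _, _⟩ := hF
  obtain ⟨_, _, _⟩ := hF'
  exact ⟨inferInstance, inferInstance, inferInstance⟩

variable {C : Type u} [Category.{v} C] [Abelian C] [Linear k C]
  {D : Type u'} [Category.{v} D] [Abelian D] [Linear k D] {box : C ⥤ C ⥤ D}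

namespace IsDeligneSquare

variable {B : Type t} [Category.{v} B] [Abelian B] [Linear k B]

theorem exists_extension (h : IsDeligneSquare.{w, v, u, u', t} k box) {H : C ⥤ C ⥤ B}
    (hH : IsBilinearRightExact k H) :
    ∃ G : D ⥤ B, IsLinearRightExact k G ∧
      Nonempty ((Functor.postcompose₂.obj G).obj box ≅ H) := by
  have := h.universal B
  let H' : BilinRexFunctor k C C B := ⟨H, hH⟩
  let G := (restrictAlong k h.bilinear B).objPreimage H'
  exact ⟨G.obj, G.property,
    ⟨(ObjectProperty.ι _).mapIso ((restrictAlong k h.bilinear B).objObjPreimageIso H')⟩⟩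

variable {F F' : D ⥤ B}

theorem exists_natTrans (h : IsDeligneSquare.{w, v, u, u', t} k box)
    (hF : IsLinearRightExact k F) (hF' : IsLinearRightExact k F')
    (φ : (Functor.postcompose₂.obj F).obj box ⟶ (Functor.postcompose₂.obj F').obj box) :
    ∃ α : F ⟶ F', ∀ X Y : C, α.app ((box.obj X).obj Y) = (φ.app X).app Y := by
  have := h.universal B
  let R := restrictAlong k h.bilinear B
  let φ' : R.obj ⟨F, hF⟩ ⟶ R.obj ⟨F', hF'⟩ := ObjectProperty.homMk φ
  exact ⟨(R.preimage φ').hom, fun X Y =>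
    congrArg (fun ψ => (ψ.hom.app X).app Y) (R.map_preimage φ')⟩

theorem natTrans_ext (h : IsDeligneSquare.{w, v, u, u', t} k box)
    (hF : IsLinearRightExact k F) (hF' : IsLinearRightExact k F') {α α' : F ⟶ F'}
    (hα : ∀ X Y : C, α.app ((box.obj X).obj Y) = α'.app ((box.obj X).obj Y)) : α = α' := by
  have := h.universal B
  let R := restrictAlong k h.bilinear B
  let a : (⟨F, hF⟩ : LinRexFunctor k D B) ⟶ ⟨F', hF'⟩ := ObjectProperty.homMk α
  let a' : (⟨F, hF⟩ : LinRexFunctor k D B) ⟶ ⟨F', hF'⟩ := ObjectProperty.homMk α'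
  have : R.map a = R.map a' := by
    ext X Y
    exact hα X Y
  exact congrArg (·.hom) (R.map_injective this)

theorem isIso_of_isIso_app (h : IsDeligneSquare.{w, v, u, u', t} k box)
    (hF : IsLinearRightExact k F) (hF' : IsLinearRightExact k F') (α : F ⟶ F')
    (hα : ∀ X Y : C, IsIso (α.app ((box.obj X).obj Y))) : IsIso α := by
  obtain ⟨β, hβ⟩ := h.exists_natTrans hF' hF
    { app X :=
        { app Y := inv (α.app ((box.obj X).obj Y))
          naturality Y Y' g := by simp }
      naturality X X' f := by ext Y; simp }
  exact ⟨β, h.natTrans_ext hF hF fun X Y => by simp [hβ],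
    h.natTrans_ext hF' hF' fun X Y => by simp [hβ]⟩

theorem isIso_of_generates (h : IsDeligneSquare.{w, v, u, u', t} k box)
    (hF : IsLinearRightExact k F) (hF' : IsLinearRightExact k F') (α : F ⟶ F') {P : C}
    (hP : ∀ U : C, ∃ (m : ℕ) (s : (⨁ fun _ : Fin m => P) ⟶ U), Epi s)
    [IsIso (α.app ((box.obj P).obj P))] : IsIso α := by
  refine h.isIso_of_isIso_app hF hF' α fun X Y => ?_
  have isIso_left : IsIso (α.app ((box.obj X).obj P)) := by
    obtain ⟨_, _, _⟩ := (h.bilinear.left P).comp hF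
    obtain ⟨_, _, _⟩ := (h.bilinear.left P).comp hF'
    let αP := Functor.whiskerLeft (box.flip.obj P) α
    have : IsIso (αP.app P) := ‹IsIso (α.app ((box.obj P).obj P))›
    exact isIso_app_of_generates αP hP X
  obtain ⟨_, _, _⟩ := (h.bilinear.right X).comp hF
  obtain ⟨_, _, _⟩ := (h.bilinear.right X).comp hF'
  let αX := Functor.whiskerLeft (box.obj X) α
  have : IsIso (αX.app P) := isIso_left
  exact isIso_app_of_generates αX hP Y

end IsDeligneSquare
end Deligne

section HomInto

theorem comp_algHom_algebraMap {k : Type*} [Field k] {D : Type*} [Category* D] [Preadditive D]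
    [Linear k D] {A : Type*} [Ring A] [Algebra k A] {Z W : D} (ρ : A →ₐ[k] End W) (a : k)
    (f : Z ⟶ W) : f ≫ ρ (algebraMap k A a) = a • f := by
  rw [ρ.commutes]
  exact (Linear.comp_smul _ _ _ f a (𝟙 W)).trans (congrArg (a • ·) (Category.comp_id f))

variable {k : Type w} [Field k] {D : Type u} [Category.{v} D] [Abelian D] [Linear k D]
  {A : Type t} [Ring A] [Algebra k A] {W : D}

/-- The functor `Hom(-, W)`, covariant with values in the opposite of the category of modules over
an algebra `A` acting on `W`. -/
noncomputable def homInto (ρ : A →ₐ[k] End W) : D ⥤ (ModuleCat.{v} A)ᵒᵖ :=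
  (preadditiveYonedaObj W ⋙ ModuleCat.restrictScalars ρ.toRingHom).rightOp

theorem isLinearRightExact_homInto (ρ : A →ₐ[k] End W) :
    IsLinearRightExact k (homInto ρ) where
  additive :=
    inferInstanceAs (preadditiveYonedaObj W ⋙ ModuleCat.restrictScalars _).rightOp.Additive
  linear := { map_smul f a := Quiver.Hom.unop_inj <| by
                ext (g : _ ⟶ W)
                refine Eq.trans ?_ (comp_algHom_algebraMap ρ a (f ≫ g)).symm
                exact Linear.smul_comp _ _ _ a f g }
  rightExact := by
    let H := preadditiveYonedaObj W ⋙ ModuleCat.restrictScalars ρ.toRingHom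
    have : PreservesLimits (H ⋙ forget (ModuleCat.{v} A)) :=
      inferInstanceAs (PreservesLimits (yoneda.obj W))
    have : PreservesLimits H := preservesLimits_of_reflects_of_preserves H (forget _)
    exact preservesFiniteColimits_rightOp H

variable {D' : Type u'} [Category.{v} D'] [Abelian D'] [Linear k D'] {W' : D'}
  {ρ : A →ₐ[k] End W} {ρ' : A →ₐ[k] End W'}

/-- A linear map `Hom(Z, W) → Hom(Z', W')` as a morphism in the opposite of the category of modules
over an algebra `A` in which every element is a scalar. -/
noncomputable def homIntoHom (hA : Function.Surjective (algebraMap k A)) {Z : D} {Z' : D'}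
    (φ : (Z ⟶ W) →ₗ[k] (Z' ⟶ W')) : (homInto ρ').obj Z' ⟶ (homInto ρ).obj Z :=
  Quiver.Hom.op (X := ((homInto ρ).obj Z).unop) (Y := ((homInto ρ').obj Z').unop) <|
    ModuleCat.ofHom (X := ((homInto ρ).obj Z).unop) (Y := ((homInto ρ').obj Z').unop)
      { toFun := φ
        map_add' := map_add φ
        map_smul' := hA.forall.2 fun a (f : Z ⟶ W) => by
          refine (congrArg φ (comp_algHom_algebraMap ρ a f)).trans ?_
          exact (φ.map_smul a f).trans (comp_algHom_algebraMap ρ' a (φ f)).symm }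

theorem isIso_homIntoHom_iff (hA : Function.Surjective (algebraMap k A)) {Z : D} {Z' : D'}
    (φ : (Z ⟶ W) →ₗ[k] (Z' ⟶ W')) :
    IsIso (homIntoHom (ρ := ρ) (ρ' := ρ') hA φ) ↔ Function.Bijective φ :=
  (isIso_unop_iff _).symm.trans (ConcreteCategory.isIso_iff_bijective (C := ModuleCat.{v} A) _)

/-- Postcomposition `f ↦ F(f) ≫ r` with a morphism `r : F(W) ⟶ W'`, as a linear map
`Hom(Z, W) → Hom(F(Z), W')`. -/
def mapCompLinear (F : D ⥤ D') [F.Additive] [F.Linear k] (r : F.obj W ⟶ W') (Z : D) :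
    (Z ⟶ W) →ₗ[k] (F.obj Z ⟶ W') :=
  Linear.rightComp k _ r ∘ₗ F.mapLinearMap k

/-- The maps `f ↦ F(f) ≫ r` from `Hom(-, W)` to `Hom(F(-), W')`, as a natural transformation between
functors to the opposite of the category of modules. -/
noncomputable def mapCompNatTrans (hA : Function.Surjective (algebraMap k A)) (F : D ⥤ D')
    [F.Additive] [F.Linear k] (r : F.obj W ⟶ W') : F ⋙ homInto ρ' ⟶ homInto ρ where
  app Z := homIntoHom hA (mapCompLinear F r Z)
  naturality Z Z' g := Quiver.Hom.unop_inj <| by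
    ext (f : Z' ⟶ W)
    exact (Category.assoc _ _ _).symm.trans (congrArg (· ≫ r) (F.map_comp g f).symm)

variable (k W W') in
/-- `A` is the image of `k` in the endomorphisms of `W` and `W'`; unlike `k`, it is small enough
for the modules over it to form a test category of a Deligne product. -/
theorem exists_surjective_algebraMap_and_action :
    ∃ (A : Type (max v t)) (_ : Ring A) (_ : Algebra k A),
      Function.Surjective (algebraMap k A) ∧ Nonempty (A →ₐ[k] End W) ∧
        Nonempty (A →ₐ[k] End W') := by
  let S : Subalgebra k (End W × End W') := ⊥
  let incl : ULift.{t} S →ₐ[k] End W × End W' := S.val.comp ULift.algEquiv.toAlgHom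
  refine ⟨ULift.{t} S, inferInstance, inferInstance, ?_,
    ⟨(AlgHom.fst k _ _).comp incl⟩, ⟨(AlgHom.snd k _ _).comp incl⟩⟩
  rintro ⟨⟨x, hx⟩⟩
  obtain ⟨a, rfl⟩ := Algebra.mem_bot.1 hx
  exact ⟨a, rfl⟩

end HomInto

section Box

variable {C : Type*} [Category* C] {D : Type*} [Category* D]

/-- The morphism `x ⊠ y`. -/
def boxMap (box : C ⥤ C ⥤ D) {X X' Y Y' : C} (x : X ⟶ X') (y : Y ⟶ Y') :
    (box.obj X).obj Y ⟶ (box.obj X').obj Y' :=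
  (box.map x).app Y ≫ (box.obj X').map y

variable (box : C ⥤ C ⥤ D)

theorem boxMap_comp {X X' X'' Y Y' Y'' : C} (x : X ⟶ X') (x' : X' ⟶ X'')
    (y : Y ⟶ Y') (y' : Y' ⟶ Y'') :
    boxMap box (x ≫ x') (y ≫ y') = boxMap box x y ≫ boxMap box x' y' := by
  simp [boxMap]

theorem boxMap_id (X Y : C) : boxMap box (𝟙 X) (𝟙 Y) = 𝟙 _ := by
  simp [boxMap]

theorem boxMap_id_right {X X' : C} (x : X ⟶ X') (Y : C) :
    boxMap box x (𝟙 Y) = (box.map x).app Y := by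
  simp [boxMap]

theorem boxMap_id_left (X : C) {Y Y' : C} (y : Y ⟶ Y') :
    boxMap box (𝟙 X) y = (box.obj X).map y := by
  simp [boxMap]

theorem map_boxMap_comp_app {E : Type*} [Category* E] {box} {G : D ⥤ E} {H : C ⥤ C ⥤ E}
    (η : (Functor.postcompose₂.obj G).obj box ⟶ H) {X X' Y Y' : C} (x : X ⟶ X') (y : Y ⟶ Y') :
    G.map (boxMap box x y) ≫ (η.app X').app Y' = (η.app X).app Y ≫ boxMap H x y := by
  have left : G.map ((box.map x).app Y) ≫ (η.app X').app Y =
      (η.app X).app Y ≫ (H.map x).app Y := NatTrans.congr_app (η.naturality x) Y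
  have right : G.map ((box.obj X').map y) ≫ (η.app X').app Y' =
      (η.app X').app Y ≫ (H.obj X').map y := (η.app X').naturality y
  rw [boxMap, boxMap, G.map_comp, Category.assoc, right, reassoc_of% left]

end Box

section Density

universe s

variable {k : Type w} [Field k] {C : Type u} [Category.{v} C] [Abelian C] [Linear k C]
  {D : Type u'} [Category.{v} D] [Abelian D] [Linear k D] {box : C ⥤ C ⥤ D}
  {B : Type s} [Category.{v} B] [Abelian B] [Linear k B]
  {F : D ⥤ B} {W : D} {W' : B}

namespace IsDeligneSquare

theorem exists_map_comp_eq (h : IsDeligneSquare.{w, v, u, u', max (v + 1) t} k box)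
    (hF : IsLinearRightExact k F)
    (φ : ∀ X Y : C, ((box.obj X).obj Y ⟶ W) →ₗ[k] (F.obj ((box.obj X).obj Y) ⟶ W'))
    (hφ : ∀ {X X' Y Y' : C} (x : X ⟶ X') (y : Y ⟶ Y') (f : (box.obj X').obj Y' ⟶ W),
      φ X Y (boxMap box x y ≫ f) = F.map (boxMap box x y) ≫ φ X' Y' f) :
    ∃ r : F.obj W ⟶ W', ∀ (X Y : C) (f : (box.obj X).obj Y ⟶ W), φ X Y f = F.map f ≫ r := by
  obtain ⟨A, _, _, hA, ⟨ρ⟩, ⟨ρ'⟩⟩ := exists_surjective_algebraMap_and_action.{w, v, u', s, t} k W W'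
  obtain ⟨α, hα⟩ := h.exists_natTrans (hF.comp (isLinearRightExact_homInto ρ'))
    (isLinearRightExact_homInto ρ)
    { app X :=
        { app Y := homIntoHom hA (φ X Y)
          naturality Y Y' y := Quiver.Hom.unop_inj <| by
            ext (f : _ ⟶ W)
            have := hφ (𝟙 X) y f
            rw [boxMap_id_left] at this
            exact this.symm }
      naturality X X' x := by
        ext Y
        refine Quiver.Hom.unop_inj ?_
        ext (f : _ ⟶ W)
        have := hφ x (𝟙 Y) f
        rw [boxMap_id_right] at this
        exact this.symm }
  refine ⟨ModuleCat.Hom.hom (α.app W).unop (𝟙 W), fun X Y f => ?_⟩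
  have := congrArg (fun β => ModuleCat.Hom.hom β.unop (𝟙 W)) (α.naturality f)
  rw [hα] at this
  exact (congrArg (φ X Y) (Category.comp_id f).symm).trans this.symm

theorem hom_ext_of_map_comp (h : IsDeligneSquare.{w, v, u, u', max (v + 1) t} k box)
    (hF : IsLinearRightExact k F) {r r' : F.obj W ⟶ W'}
    (hr : ∀ (X Y : C) (f : (box.obj X).obj Y ⟶ W), F.map f ≫ r = F.map f ≫ r') : r = r' := by
  obtain ⟨A, _, _, hA, ⟨ρ⟩, ⟨ρ'⟩⟩ := exists_surjective_algebraMap_and_action.{w, v, u', s, t} k W W'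
  have := hF.additive
  have := hF.linear
  have hrr' : mapCompNatTrans (ρ := ρ) (ρ' := ρ') hA F r = mapCompNatTrans hA F r' :=
    h.natTrans_ext (hF.comp (isLinearRightExact_homInto ρ')) (isLinearRightExact_homInto ρ)
      fun X Y => congrArg (homIntoHom hA) (LinearMap.ext (hr X Y))
  have : F.map (𝟙 W) ≫ r = F.map (𝟙 W) ≫ r' :=
    congrArg (fun β => ModuleCat.Hom.hom (β.app W).unop (𝟙 W)) hrr'
  simpa using this

theorem exists_natTrans_of_linear (h : IsDeligneSquare.{w, v, u, u', max (v + 1) t} k box)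
    (hF : IsLinearRightExact k F) {K : D ⥤ B} [K.Additive] [K.Linear k]
    (κ : ∀ X Y : C, F.obj ((box.obj X).obj Y) ⟶ K.obj ((box.obj X).obj Y))
    (hκ : ∀ {X X' Y Y' : C} (x : X ⟶ X') (y : Y ⟶ Y'),
      F.map (boxMap box x y) ≫ κ X' Y' = κ X Y ≫ K.map (boxMap box x y)) :
    ∃ θ : F ⟶ K, ∀ X Y : C, θ.app ((box.obj X).obj Y) = κ X Y := by
  have exists_component (W : D) : ∃ r : F.obj W ⟶ K.obj W,
      ∀ (X Y : C) (f : (box.obj X).obj Y ⟶ W), κ X Y ≫ K.map f = F.map f ≫ r :=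
    h.exists_map_comp_eq hF (fun X Y => Linear.leftComp k (K.obj W) (κ X Y) ∘ₗ K.mapLinearMap k)
      fun {X X' Y Y'} x y f => by
        change κ X Y ≫ K.map (boxMap box x y ≫ f) = _ ≫ κ X' Y' ≫ K.map f
        rw [K.map_comp, reassoc_of% hκ]
  choose θ hθ using exists_component
  refine ⟨{ app := θ, naturality W W' q := ?_ }, fun X Y => ?_⟩
  · refine h.hom_ext_of_map_comp hF fun X Y f => ?_
    rw [← Category.assoc, ← F.map_comp, ← hθ, ← Category.assoc, ← hθ, K.map_comp, Category.assoc]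
  · simpa using (hθ _ X Y (𝟙 _)).symm

theorem bijective_map_comp (h : IsDeligneSquare.{w, v, u, u', max (v + 1) t} k box)
    (hF : IsLinearRightExact k F) (r : F.obj W ⟶ W') {P : C}
    (hP : ∀ U : C, ∃ (m : ℕ) (s : (⨁ fun _ : Fin m => P) ⟶ U), Epi s)
    (hr : Function.Bijective fun f : (box.obj P).obj P ⟶ W => F.map f ≫ r) (Z : D) :
    Function.Bijective fun f : Z ⟶ W => F.map f ≫ r := by
  obtain ⟨A, _, _, hA, ⟨ρ⟩, ⟨ρ'⟩⟩ := exists_surjective_algebraMap_and_action.{w, v, u', s, t} k W W'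
  have := hF.additive
  have := hF.linear
  let α : F ⋙ homInto ρ' ⟶ homInto ρ := mapCompNatTrans hA F r
  have : IsIso (α.app ((box.obj P).obj P)) := (isIso_homIntoHom_iff hA _).2 hr
  have : IsIso α := h.isIso_of_generates (hF.comp (isLinearRightExact_homInto ρ'))
    (isLinearRightExact_homInto ρ) α hP
  exact (isIso_homIntoHom_iff hA (mapCompLinear F r Z)).1
    (inferInstance : IsIso (α.app Z))

end IsDeligneSquare

end Density

section HomTensor

open TensorProduct TensorProduct.AlgebraTensorModule

theorem moduleCat_tensor_hom_ext {R : Type w} [CommRing R] {S : Type t} [Ring S]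
    {M N : Type v} [AddCommGroup M] [AddCommGroup N] [Module R M] [Module R N]
    [Module S (M ⊗[R] N)] {L : ModuleCat.{v} S} {φ φ' : ModuleCat.of S (M ⊗[R] N) ⟶ L}
    (h : ∀ x y, φ.hom (x ⊗ₜ[R] y) = φ'.hom (x ⊗ₜ[R] y)) : φ = φ' := by
  ext z
  induction z using TensorProduct.induction_on with
  | zero => simp only [map_zero]
  | tmul => exact h _ _
  | add z z' hz hz' => simp only [map_add, hz, hz']

variable {k : Type w} [Field k] {C : Type u} [Category.{v} C] [Abelian C] [Linear k C]

theorem isLinearRightExact_of_exact {S : Type t} [Ring S] [Algebra k S]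
    {F : C ⥤ ModuleCat.{v} S} (hadd : F.Additive) (hlin : F.Linear k)
    (hex : ∀ T : ShortComplex C, T.ShortExact →
      Function.Exact (F.map T.f).hom (F.map T.g).hom ∧ Function.Surjective (F.map T.g).hom) :
    IsLinearRightExact k F where
  additive := hadd
  linear := hlin
  rightExact := F.preservesFiniteColimits_iff_forall_exact_map_and_epi.2 fun T hT =>
    ⟨(ShortComplex.ShortExact.moduleCat_exact_iff_function_exact (T.map F)).2 (hex T hT).1,
      (ModuleCat.epi_iff_surjective _).2 (hex T hT).2⟩

theorem isLinearRightExact_restrictScalars {S : Type t} {S' : Type u} [Ring S] [Algebra k S]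
    [Ring S'] [Algebra k S'] (ρ : S →ₐ[k] S') :
    IsLinearRightExact k (ModuleCat.restrictScalars.{v} ρ.toRingHom) :=
  isLinearRightExact_of_exact inferInstance inferInstance fun T hT =>
    ⟨(ShortComplex.ShortExact.moduleCat_exact_iff_function_exact T).1 hT.exact,
      (ModuleCat.epi_iff_surjective T.g).1 hT.epi_g⟩

theorem rightComp_exact_and_surjective (P : C) [Projective P] {T : ShortComplex C}
    (hT : T.ShortExact) :
    Function.Exact (Linear.rightComp k P T.f) (Linear.rightComp k P T.g) ∧
      Function.Surjective (Linear.rightComp k P T.g) := by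
  have := hT.mono_f
  have := hT.epi_g
  refine ⟨fun y => ⟨fun hy => ⟨hT.exact.lift y hy, hT.exact.lift_f y hy⟩, ?_⟩,
    fun z => ⟨Projective.factorThru z T.g, Projective.factorThru_comp _ _⟩⟩
  rintro ⟨x, rfl⟩
  exact (Category.assoc _ _ _).trans ((congrArg (x ≫ ·) T.zero).trans comp_zero)

variable (k) (P : C)

instance homIsScalarTower (X : C) : IsScalarTower k (End P)ᵐᵒᵖ (P ⟶ X) where
  smul_assoc a x f := Linear.smul_comp (R := k) P P X a x.unop f

/-- Postcomposition with `f` on `Hom(P, -)`, linear over the endomorphisms of `P` acting by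
precomposition. -/
def endOpRightComp {X X' : C} (f : X ⟶ X') : (P ⟶ X) →ₗ[ULift.{t} (End P)ᵐᵒᵖ] (P ⟶ X') where
  toFun x := x ≫ f
  map_add' x y := Preadditive.add_comp _ _ _ x y f
  map_smul' a x := Category.assoc a.down.unop x f

/-- The functor of two variables `(X, Y) ↦ Hom(P, X) ⊗ Hom(P, Y)`, with values in modules over the
endomorphisms of `P` acting on the first factor. These replace `k` because `k` may live in too large
a universe for its module category to be a test category. -/
noncomputable def homTensor : C ⥤ C ⥤ ModuleCat.{v} (ULift.{t} (End P)ᵐᵒᵖ) where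
  obj X :=
    { obj Y := ModuleCat.of _ ((P ⟶ X) ⊗[k] (P ⟶ Y))
      map g := ModuleCat.ofHom (lTensor _ _ (Linear.rightComp k P g))
      map_id _ := moduleCat_tensor_hom_ext fun x y => congrArg (x ⊗ₜ[k] ·) (Category.comp_id y)
      map_comp g g' := moduleCat_tensor_hom_ext fun x y =>
        congrArg (x ⊗ₜ[k] ·) (Category.assoc y g g').symm }
  map f :=
    { app _ := ModuleCat.ofHom (rTensor _ _ (endOpRightComp P f))
      naturality _ _ _ := moduleCat_tensor_hom_ext fun _ _ => rfl }
  map_id _ := NatTrans.ext <| funext fun _ => moduleCat_tensor_hom_ext fun x y =>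
    congrArg (· ⊗ₜ[k] y) (Category.comp_id x)
  map_comp f f' := NatTrans.ext <| funext fun _ => moduleCat_tensor_hom_ext fun x y =>
    congrArg (· ⊗ₜ[k] y) (Category.assoc x f f').symm

theorem homTensor_obj_map_hom (X : C) {Y Y' : C} (g : Y ⟶ Y') :
    ⇑(((homTensor.{w, v, u, t} k P).obj X).map g).hom =
      LinearMap.lTensor (P ⟶ X) (Linear.rightComp k P g) :=
  rfl

theorem homTensor_map_app_hom {X X' : C} (f : X ⟶ X') (Y : C) :
    ⇑(((homTensor.{w, v, u, t} k P).map f).app Y).hom =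
      LinearMap.rTensor (P ⟶ Y) (Linear.rightComp k P f) :=
  rfl

theorem boxMap_homTensor_hom {X X' Y Y' : C} (x : X ⟶ X') (y : Y ⟶ Y')
    (z : (P ⟶ X) ⊗[k] (P ⟶ Y)) :
    (boxMap (homTensor.{w, v, u, t} k P) x y).hom z =
      TensorProduct.map (Linear.rightComp k P x) (Linear.rightComp k P y) z := by
  refine Eq.trans ?_ (LinearMap.congr_fun (LinearMap.lTensor_comp_rTensor _ _ _) z)
  rfl

theorem isBilinearRightExact_homTensor [Projective P] :
    IsBilinearRightExact k (homTensor.{w, v, u, t} k P) where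
  left Y := isLinearRightExact_of_exact
    ⟨fun {_ _ f f'} => moduleCat_tensor_hom_ext fun x y =>
      (congrArg (· ⊗ₜ[k] y) (Preadditive.comp_add _ _ _ x f f')).trans (add_tmul _ _ _)⟩
    ⟨fun f a => moduleCat_tensor_hom_ext fun x y => by
      change (x ≫ (a • f)) ⊗ₜ[k] y = (algebraMap k (ULift.{t} (End P)ᵐᵒᵖ) a) • ((x ≫ f) ⊗ₜ[k] y)
      rw [algebraMap_smul, Linear.comp_smul, smul_tmul']⟩
    fun T hT => by
      obtain ⟨hex, hsurj⟩ := rightComp_exact_and_surjective (k := k) P hT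
      have exact_tensor := rTensor_exact (P ⟶ Y) hex hsurj
      have surj_tensor := LinearMap.rTensor_surjective (P ⟶ Y) hsurj
      rw [← homTensor_map_app_hom.{w, v, u, t},
        ← homTensor_map_app_hom.{w, v, u, t}] at exact_tensor
      rw [← homTensor_map_app_hom.{w, v, u, t}] at surj_tensor
      exact ⟨exact_tensor, surj_tensor⟩
  right X := isLinearRightExact_of_exact
    ⟨fun {_ _ g g'} => moduleCat_tensor_hom_ext fun x y =>
      (congrArg (x ⊗ₜ[k] ·) (Preadditive.comp_add _ _ _ y g g')).trans (tmul_add _ _ _)⟩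
    ⟨fun g a => moduleCat_tensor_hom_ext fun x y => by
      change x ⊗ₜ[k] (y ≫ (a • g)) = (algebraMap k (ULift.{t} (End P)ᵐᵒᵖ) a) • (x ⊗ₜ[k] (y ≫ g))
      rw [algebraMap_smul, Linear.comp_smul, tmul_smul]⟩
    fun T hT => by
      obtain ⟨hex, hsurj⟩ := rightComp_exact_and_surjective (k := k) P hT
      have exact_tensor := lTensor_exact (P ⟶ X) hex hsurj
      have surj_tensor := LinearMap.lTensor_surjective (P ⟶ X) hsurj
      rw [← homTensor_obj_map_hom.{w, v, u, t},
        ← homTensor_obj_map_hom.{w, v, u, t}] at exact_tensor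
      rw [← homTensor_obj_map_hom.{w, v, u, t}] at surj_tensor
      exact ⟨exact_tensor, surj_tensor⟩

namespace IsDeligneSquare

variable {D : Type u'} [Category.{v} D] [Abelian D] [Linear k D] {box : C ⥤ C ⥤ D}

theorem exists_homTensor_extension (h : IsDeligneSquare.{w, v, u, u', max (v + 1) t} k box)
    [Projective P] :
    ∃ G : D ⥤ ModuleCat.{v} k, IsLinearRightExact k G ∧
      ∃ e : ∀ X Y : C, G.obj ((box.obj X).obj Y) ≃ₗ[k] (P ⟶ X) ⊗[k] (P ⟶ Y),
        ∀ {X X' Y Y' : C} (x : X ⟶ X') (y : Y ⟶ Y') (z : G.obj ((box.obj X).obj Y)),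
          e X' Y' (G.map (boxMap box x y) z) =
            TensorProduct.map (Linear.rightComp k P x) (Linear.rightComp k P y) (e X Y z) := by
  let S := ULift.{t} (End P)ᵐᵒᵖ
  obtain ⟨G, hG, ⟨η⟩⟩ := h.exists_extension (isBilinearRightExact_homTensor.{w, v, u, t} k P)
  let res := ModuleCat.restrictScalars.{v} (Algebra.ofId k S).toRingHom
  let e (X Y : C) : (G ⋙ res).obj ((box.obj X).obj Y) ≃+ (P ⟶ X) ⊗[k] (P ⟶ Y) :=
    ((η.app X).app Y).toLinearEquiv.toAddEquiv
  refine ⟨G ⋙ res, hG.comp (isLinearRightExact_restrictScalars _),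
    fun X Y => (e X Y).toLinearEquiv fun a z => ?_, fun {X X' Y Y'} x y z => ?_⟩
  · exact (((η.app X).app Y).toLinearEquiv.map_smul (algebraMap k S a) z).trans
      (algebraMap_smul S a (e X Y z))
  · exact (congrArg (fun q => q.hom z) (map_boxMap_comp_app η.hom x y)).trans
      (boxMap_homTensor_hom.{w, v, u, t} k P x y (e X Y z))

end IsDeligneSquare

end HomTensor

section BoxLinear

open TensorProduct

variable {k : Type w} [Field k] {C : Type u} [Category.{v} C] [Abelian C] [Linear k C]
  {D : Type u'} [Category.{v} D] [Abelian D] [Linear k D] {box : C ⥤ C ⥤ D}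

/-- The linear map `x ⊗ y ↦ x ⊠ y`. -/
def boxLinearMap (hbox : IsBilinearRightExact k box) (X X' Y Y' : C) :
    (X ⟶ X') ⊗[k] (Y ⟶ Y') →ₗ[k] ((box.obj X).obj Y ⟶ (box.obj X').obj Y') :=
  have := (hbox.left Y).additive
  have := (hbox.left Y).linear
  have := (hbox.right X').additive
  have := (hbox.right X').linear
  TensorProduct.lift <| (Linear.comp _ _ _).compl₁₂
    ((box.flip.obj Y).mapLinearMap k) ((box.obj X').mapLinearMap k)

theorem boxLinearMap_tmul (hbox : IsBilinearRightExact k box) {X X' Y Y' : C} (x : X ⟶ X')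
    (y : Y ⟶ Y') : boxLinearMap hbox X X' Y Y' (x ⊗ₜ[k] y) = boxMap box x y :=
  rfl

theorem boxLinearMap_map_rightComp (hbox : IsBilinearRightExact k box) (P : C) {X X' Y Y' : C}
    (x : X ⟶ X') (y : Y ⟶ Y') (z : (P ⟶ X) ⊗[k] (P ⟶ Y)) :
    boxLinearMap hbox P X' P Y'
        (TensorProduct.map (Linear.rightComp k P x) (Linear.rightComp k P y) z) =
      boxLinearMap hbox P X P Y z ≫ boxMap box x y := by
  induction z using TensorProduct.induction_on with
  | zero => simp only [map_zero, zero_comp]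
  | tmul p q =>
    simp only [TensorProduct.map_tmul, boxLinearMap_tmul, Linear.rightComp_apply, boxMap_comp]
  | add z z' hz hz' => simp only [map_add, Preadditive.add_comp, hz, hz']

namespace IsDeligneSquare

/-- The map `x ⊗ y ↦ x ⊠ y` hits `𝟙 (P ⊠ P)`, so by naturality it hits everything. -/
theorem exists_surjective_homTensor_to_coyoneda
    (h : IsDeligneSquare.{w, v, u, u', max (v + 1) t} k box) (P : C) [Projective P] :
    ∃ G : D ⥤ ModuleCat.{v} k, IsLinearRightExact k G ∧
      (∀ X Y : C, Nonempty (G.obj ((box.obj X).obj Y) ≃ₗ[k] (P ⟶ X) ⊗[k] (P ⟶ Y))) ∧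
      ∃ θ : G ⟶ (linearCoyoneda k D).obj (op ((box.obj P).obj P)),
        ∀ W : D, Function.Surjective (θ.app W).hom := by
  obtain ⟨G, hG, e, he⟩ := h.exists_homTensor_extension k P
  let K := (linearCoyoneda k D).obj (op ((box.obj P).obj P))
  let κ (X Y : C) : G.obj ((box.obj X).obj Y) →ₗ[k] ((box.obj P).obj P ⟶ (box.obj X).obj Y) :=
    boxLinearMap h.bilinear P X P Y ∘ₗ (e X Y).toLinearMap
  have map_κ {X X' Y Y' : C} (x : X ⟶ X') (y : Y ⟶ Y') :
      G.map (boxMap box x y) ≫ ModuleCat.ofHom (κ X' Y') =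
        ModuleCat.ofHom (κ X Y) ≫ K.map (boxMap box x y) :=
    ModuleCat.hom_ext <| LinearMap.ext fun z =>
      (congrArg (boxLinearMap h.bilinear P X' P Y') (he x y z)).trans
        (boxLinearMap_map_rightComp h.bilinear P x y (e X Y z))
  have : K.Linear k :=
    ⟨fun f a => ModuleCat.hom_ext <| LinearMap.ext fun q => Linear.comp_smul _ _ _ q a f⟩
  obtain ⟨θ, hθ⟩ :=
    h.exists_natTrans_of_linear hG (K := K) (fun X Y => ModuleCat.ofHom (κ X Y)) map_κ
  refine ⟨G, hG, fun X Y => ⟨e X Y⟩, θ, fun W f => ?_⟩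
  let one := (e P P).symm (𝟙 P ⊗ₜ 𝟙 P)
  have θ_one : (θ.app ((box.obj P).obj P)).hom one = 𝟙 ((box.obj P).obj P) := by
    have e_one : e P P one = 𝟙 P ⊗ₜ 𝟙 P := (e P P).apply_symm_apply _
    rw [hθ]
    change boxLinearMap h.bilinear P P P P (e P P one) = _
    rw [e_one, boxLinearMap_tmul, boxMap_id]
  refine ⟨G.map f one, ?_⟩
  have := congrArg (fun q => q.hom one) (θ.naturality f)
  exact this.trans ((congrArg (· ≫ f) θ_one).trans (Category.id_comp f))

theorem projective_box (h : IsDeligneSquare.{w, v, u, u', max (v + 1) t} k box) (P : C)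
    [Projective P] : Projective ((box.obj P).obj P) where
  factors {W W'} f p _ := by
    obtain ⟨G, ⟨_, _, _⟩, _, θ, hθ⟩ := h.exists_surjective_homTensor_to_coyoneda P
    obtain ⟨z, hz⟩ := hθ W' f
    obtain ⟨y, hy⟩ := (ModuleCat.epi_iff_surjective (G.map p)).1 inferInstance z
    refine ⟨(θ.app _).hom y, ?_⟩
    have := congrArg (fun q => q.hom y) (θ.naturality p)
    refine this.symm.trans (Eq.trans ?_ hz)
    exact congrArg (θ.app _).hom hy

theorem finiteDimensional_hom_box (h : IsDeligneSquare.{w, v, u, u', max (v + 1) t} k box) (P : C)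
    [Projective P] (X Y : C) [FiniteDimensional k (P ⟶ X)] [FiniteDimensional k (P ⟶ Y)] :
    FiniteDimensional k ((box.obj P).obj P ⟶ (box.obj X).obj Y) := by
  obtain ⟨G, _, e, θ, hθ⟩ := h.exists_surjective_homTensor_to_coyoneda P
  obtain ⟨e⟩ := e X Y
  have := Module.Finite.equiv e.symm
  exact Module.Finite.of_surjective (θ.app _).hom (hθ _)

end IsDeligneSquare

end BoxLinear

section Finite

variable {k : Type w} [Field k] {C : Type u} [Category.{v} C] [Abelian C] [Linear k C]

theorem finiteDimensional_hom_of_epi_biproduct {P X Y : C} [FiniteDimensional k (P ⟶ Y)]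
    {m : ℕ} (s : (⨁ fun _ : Fin m => P) ⟶ X) [Epi s] : FiniteDimensional k (X ⟶ Y) := by
  let L : (X ⟶ Y) →ₗ[k] (Fin m → (P ⟶ Y)) :=
    LinearMap.pi fun i => Linear.leftComp k Y (biproduct.ι (fun _ : Fin m => P) i ≫ s)
  refine FiniteDimensional.of_injective L ((injective_iff_map_eq_zero _).2 fun f hf => ?_)
  rw [← cancel_epi s, comp_zero]
  refine biproduct.hom_ext' _ _ fun i => ?_
  simpa [L] using congrFun hf i

theorem finiteDimensional_hom_of_projective {P X Y : C} [Projective P]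
    [FiniteDimensional k (P ⟶ X)] {m : ℕ} (s : (⨁ fun _ : Fin m => X) ⟶ Y) [Epi s] :
    FiniteDimensional k (P ⟶ Y) := by
  let L : (Fin m → (P ⟶ X)) →ₗ[k] (P ⟶ Y) :=
    Linear.rightComp k P s ∘ₗ
      ∑ i, Linear.rightComp k P (biproduct.ι (fun _ : Fin m => X) i) ∘ₗ LinearMap.proj i
  refine Module.Finite.of_surjective L fun f => ?_
  refine ⟨fun i => Projective.factorThru f s ≫ biproduct.π (fun _ : Fin m => X) i, ?_⟩
  simp [L, ← Preadditive.comp_sum, biproduct.total]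

theorem SatisfiesPF.finiteDimensional_hom (h : SatisfiesPF k C) (X Y : C) :
    FiniteDimensional k (X ⟶ Y) := by
  obtain ⟨P, ⟨_, hgen⟩, _⟩ := h
  obtain ⟨_, sX, _⟩ := hgen X
  obtain ⟨_, sY, _⟩ := hgen Y
  have : FiniteDimensional k (P ⟶ Y) := finiteDimensional_hom_of_projective sY
  exact finiteDimensional_hom_of_epi_biproduct sX

end Finite

section Representability

variable {D : Type*} [Category* D] [Abelian D] {C : Type*} [Category* C] [Abelian C]
  {T : D ⥤ C} [T.Additive] {Y Z : D} {n : Z ⟶ Y} {W : C} {β : T.obj Y ⟶ W}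

theorem exists_forall_map_cokernel_π_comp_iff [PreservesFiniteColimits T]
    (hn : T.map n ≫ β = 0) :
    ∃ r : T.obj (cokernel n) ⟶ W,
      ∀ s : T.obj (cokernel n) ⟶ W, T.map (cokernel.π n) ≫ s = β ↔ s = r := by
  let r := (PreservesCokernel.iso T n).hom ≫ cokernel.desc (T.map n) β hn
  have hr : T.map (cokernel.π n) ≫ r = β := by simp [r]
  exact ⟨r, fun s => ⟨fun hs => (cancel_epi (T.map (cokernel.π n))).1 (hs.trans hr.symm),
    fun hs => hs ▸ hr⟩⟩

theorem bijective_map_comp_of_projective {Q : D} [Projective Q] {r : T.obj (cokernel n) ⟶ W}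
    (hr : T.map (cokernel.π n) ≫ r = β)
    (hker : ∀ f : Q ⟶ Y, T.map f ≫ β = 0 → ∃ g : Q ⟶ Z, g ≫ n = f)
    (hsurj : ∀ g : T.obj Q ⟶ W, ∃ f : Q ⟶ Y, T.map f ≫ β = g) :
    Function.Bijective fun f : Q ⟶ cokernel n => T.map f ≫ r := by
  have map_lift (f : Q ⟶ Y) : T.map (f ≫ cokernel.π n) ≫ r = T.map f ≫ β := by
    rw [T.map_comp, Category.assoc, hr]
  refine ⟨fun f f' hff' => ?_, fun g => ?_⟩
  · have hdiff := Projective.factorThru_comp (f - f') (cokernel.π n)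
    obtain ⟨g, hg⟩ := hker (Projective.factorThru (f - f') (cokernel.π n)) (by
      rw [← map_lift, hdiff, T.map_sub, Preadditive.sub_comp, sub_eq_zero]
      exact hff')
    rw [← sub_eq_zero, ← hdiff, ← hg, Category.assoc, cokernel.condition, comp_zero]
  · obtain ⟨f, rfl⟩ := hsurj g
    exact ⟨f ≫ cokernel.π n, map_lift f⟩

variable {k : Type w} [Field k] {D : Type u'} [Category.{v} D] [Abelian D] [Linear k D]
  {C : Type u} [Category.{v} C] [Abelian C] [Linear k C]

theorem exists_iso_linearYoneda_of_bijective {T : D ⥤ C} [T.Additive] [T.Linear k] {R : D} {W : C}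
    (r : T.obj R ⟶ W) (h : ∀ X : D, Function.Bijective fun f : X ⟶ R => T.map f ≫ r) :
    ∃ χ : T.op ⋙ (linearYoneda k C).obj W ≅ (linearYoneda k D).obj R,
      χ.hom.app (op R) r = 𝟙 R := by
  let ε : (linearYoneda k D).obj R ≅ T.op ⋙ (linearYoneda k C).obj W :=
    NatIso.ofComponents
      (fun X => (LinearEquiv.ofBijective (mapCompLinear T r X.unop) (h X.unop)).toModuleIso)
      fun {X X'} f => ModuleCat.hom_ext <| LinearMap.ext fun (g : X.unop ⟶ R) =>
        (congrArg (· ≫ r) (T.map_comp f.unop g)).trans (Category.assoc _ _ _)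
  have ε_id : ε.hom.app (op R) (𝟙 R) = r :=
    (congrArg (· ≫ r) (T.map_id R)).trans (Category.id_comp r)
  refine ⟨ε.symm, ?_⟩
  rw [← ε_id]
  exact congrArg (fun q => q.hom (𝟙 R)) (ε.hom_inv_id_app (op R))

end Representability

namespace Conjugates

variable {k : Type w} [Field k] {C : Type u} [Category.{v} C] [Abelian C]
  [Linear k C] [MonoidalCategory C] (c : Conjugates k C)

theorem exists_whiskerLeft_comp_pairing (U V : C) (g : U ⊗ V ⟶ c.conj (𝟙_ C)) :
    ∃ b : V ⟶ c.conj U, (U ◁ b) ≫ c.pairing U = g := by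
  let h : U ⟶ c.conj V := (c.π U V).symm g
  let b : V ⟶ c.conj U := c.δ.hom.app V ≫ c.star.map h.op
  have hb : c.δ.hom.app U ≫ c.star.map b.op = h := by
    have nat : c.δ.hom.app U ≫ c.star.map (c.star.map h.op).op = h ≫ c.δ.hom.app (c.conj V) :=
      (c.δ.hom.naturality h).symm
    rw [op_comp, c.star.map_comp, reassoc_of% nat, c.star_δ]
    exact (congrArg (h ≫ ·) (c.δ.hom_inv_id_app (c.conj V))).trans (Category.comp_id h)
  refine ⟨b, ?_⟩
  rw [pairing, ← c.π_natural_right, hb]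
  exact (c.π U V).apply_symm_apply g

end Conjugates

section Relations

variable {k : Type w} [Field k] {C : Type u} [Category.{v} C] [Abelian C]
  [Linear k C] [MonoidalCategory C] (c : Conjugates k C)
  {D : Type u'} [Category.{v} D] {box : C ⥤ C ⥤ D}
  {T : D ⥤ C} (τ : (Functor.postcompose₂.obj T).obj box ≅ curriedTensor C)

/-- The pairing `β_U`, transported along `T(U ⊠ U^*) ≅ U ⊗ U^*`. -/
def boxPairing (U : C) : T.obj ((box.obj U).obj (c.conj U)) ⟶ c.conj (𝟙_ C) :=
  (boxTensorIso τ U (c.conj U)).hom ≫ c.pairing U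

theorem exists_map_comp_boxPairing (U V : C) (g : T.obj ((box.obj U).obj V) ⟶ c.conj (𝟙_ C)) :
    ∃ f : (box.obj U).obj V ⟶ (box.obj U).obj (c.conj U), T.map f ≫ boxPairing c τ U = g := by
  obtain ⟨b, hb⟩ := c.exists_whiskerLeft_comp_pairing U V ((boxTensorIso τ U V).inv ≫ g)
  have nat : T.map ((box.obj U).map b) ≫ (boxTensorIso τ U (c.conj U)).hom =
      (boxTensorIso τ U V).hom ≫ U ◁ b := (τ.app U).hom.naturality b
  refine ⟨(box.obj U).map b, ?_⟩
  rw [boxPairing, reassoc_of% nat, hb, Iso.hom_inv_id_assoc]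

variable [Abelian D] [Linear k D] (hT : IsLinearRightExact k T) {τ c} {P : C}

theorem mem_relationSpace_iff {f : (box.obj P).obj P ⟶ (box.obj P).obj (c.conj P)} :
    f ∈ relationSpace c hT τ P ↔ T.map f ≫ boxPairing c τ P = 0 := by
  change (boxTensorIso τ P P).inv ≫ T.map f ≫ boxPairing c τ P = 0 ↔ _
  rw [← cancel_epi (boxTensorIso τ P P).inv, comp_zero]

variable {hT} {r : ℕ} (b : Module.Basis (Fin r) k (relationSpace c hT τ P))

theorem ι_relationMap (i : Fin r) :
    biproduct.ι (fun _ : Fin r => (box.obj P).obj P) i ≫ relationMap c hT τ P b = (b i).1 := by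
  rw [relationMap, Preadditive.comp_sum]
  refine (Finset.sum_eq_single i (fun j _ hj => ?_) (by simp)).trans (by simp)
  rw [biproduct.ι_π_ne_assoc _ hj.symm, zero_comp]

theorem map_relationMap_comp_boxPairing :
    T.map (relationMap c hT τ P b) ≫ boxPairing c τ P = 0 := by
  have := hT.additive
  rw [relationMap, T.map_sum, Preadditive.sum_comp]
  refine Finset.sum_eq_zero fun i _ => ?_
  rw [T.map_comp, Category.assoc, (mem_relationSpace_iff hT).1 (b i).2, comp_zero]

theorem exists_comp_relationMap_of_mem {f : (box.obj P).obj P ⟶ (box.obj P).obj (c.conj P)}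
    (hf : f ∈ relationSpace c hT τ P) :
    ∃ g : (box.obj P).obj P ⟶ ⨁ fun _ : Fin r => (box.obj P).obj P,
      g ≫ relationMap c hT τ P b = f := by
  let a := b.repr ⟨f, hf⟩
  refine ⟨∑ i, a i • biproduct.ι (fun _ : Fin r => (box.obj P).obj P) i, ?_⟩
  have sum_eq : ∑ i, a i • (b i).1 = f := by
    have : (∑ i, a i • b i : relationSpace c hT τ P) = ⟨f, hf⟩ := b.sum_repr _
    simpa using congrArg Subtype.val this
  simp only [Preadditive.sum_comp, Linear.smul_comp, ι_relationMap, sum_eq]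

theorem IsDeligneSquare.exists_representation_cokernel_relationMap
    (hbox : IsDeligneSquare.{w, v, u, u', max (v + 1) t} k box) (hP : IsProjectiveGenerator P) :
    ∃ r' : T.obj (cokernel (relationMap c hT τ P b)) ⟶ c.conj (𝟙_ C),
      (∀ s : T.obj (cokernel (relationMap c hT τ P b)) ⟶ c.conj (𝟙_ C),
        T.map (cokernel.π (relationMap c hT τ P b)) ≫ s = boxPairing c τ P ↔ s = r') ∧
      ∃ χ : T.op ⋙ (linearYoneda k C).obj (c.conj (𝟙_ C)) ≅
          (linearYoneda k D).obj (cokernel (relationMap c hT τ P b)),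
        χ.hom.app (op (cokernel (relationMap c hT τ P b))) r' =
          𝟙 (cokernel (relationMap c hT τ P b)) := by
  obtain ⟨_, _, _⟩ := id hT
  have := hP.projective
  have := hbox.projective_box P
  obtain ⟨r', hr'⟩ := exists_forall_map_cokernel_π_comp_iff (map_relationMap_comp_boxPairing b)
  have bijective_at_box := bijective_map_comp_of_projective ((hr' r').2 rfl)
    (fun f hf => exists_comp_relationMap_of_mem b ((mem_relationSpace_iff hT).2 hf))
    (exists_map_comp_boxPairing c τ P P)
  exact ⟨r', hr', exists_iso_linearYoneda_of_bijective r'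
    (hbox.bijective_map_comp hT r' hP.generates bijective_at_box)⟩

end Relations

theorem mainTheorem4_general
    {k : Type w} [Field k]
    {C : Type u} [Category.{v} C] [Abelian C] [Linear k C]
    [MonoidalCategory C]
    (hPF : SatisfiesPF k C)
    (c : Conjugates k C)
    {D : Type u'} [Category.{v} D] [Abelian D] [Linear k D]
    (box : C ⥤ C ⥤ D)
    (hbox : IsDeligneSquare.{w, v, u, u', max (v + 1) t} k box)
    (T : D ⥤ C) (hT : IsLinearRightExact k T)
    (τ : (Functor.postcompose₂.obj T).obj box ≅ curriedTensor C)
    (P : C) (hP : IsProjectiveGenerator P) :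
    FiniteDimensional k (relationSpace c hT τ P) ∧
    (∀ {r : ℕ} (b : Module.Basis (Fin r) k (relationSpace c hT τ P)),
      ∃ r' : T.obj (cokernel (relationMap c hT τ P b)) ⟶ c.conj (𝟙_ C),
        (∀ s : T.obj (cokernel (relationMap c hT τ P b)) ⟶ c.conj (𝟙_ C),
          T.map (cokernel.π (relationMap c hT τ P b)) ≫ s =
              (boxTensorIso τ P (c.conj P)).hom ≫ c.pairing P ↔ s = r') ∧
        ∃ χ : T.op ⋙ (linearYoneda k C).obj (c.conj (𝟙_ C)) ≅
            (linearYoneda k D).obj (cokernel (relationMap c hT τ P b)),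
          χ.hom.app (op (cokernel (relationMap c hT τ P b))) r' =
            𝟙 (cokernel (relationMap c hT τ P b))) ∧
    ∃ R : D, Nonempty (T.op ⋙ (linearYoneda k C).obj (c.conj (𝟙_ C)) ≅
      (linearYoneda k D).obj R) := by
  have := hP.projective
  have := hPF.finiteDimensional_hom
  have := hbox.finiteDimensional_hom_box P P (c.conj P)
  have finite_relations : FiniteDimensional k (relationSpace c hT τ P) := inferInstance
  refine ⟨finite_relations, fun b => hbox.exists_representation_cokernel_relationMap b hP, ?_⟩
  obtain ⟨_, _, χ, _⟩ := hbox.exists_representation_cokernel_relationMap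
    (Module.finBasis k (relationSpace c hT τ P)) hP
  exact ⟨_, ⟨χ⟩⟩

theorem mainTheorem4
    {k : Type w} [Field k] [CharZero k]
    {C : Type u} [Category.{v} C] [Abelian C] [Linear k C]
    [MonoidalCategory C] [BraidedCategory C]
    (hTensor : IsBilinearRightExact k (curriedTensor C))
    (hPF : SatisfiesPF k C)
    (c : Conjugates k C)
    {D : Type u'} [Category.{v} D] [Abelian D] [Linear k D]
    (box : C ⥤ C ⥤ D)
    (hbox : IsDeligneSquare.{w, v, u, u', max u u' (v + 1)} k box)
    (T : D ⥤ C) (hT : IsLinearRightExact k T)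
    (τ : (Functor.postcompose₂.obj T).obj box ≅ curriedTensor C)
    (P : C) (hP : IsProjectiveGenerator P) :
    FiniteDimensional k (relationSpace c hT τ P) ∧
    (∀ {r : ℕ} (b : Module.Basis (Fin r) k (relationSpace c hT τ P)),
      ∃ r' : T.obj (cokernel (relationMap c hT τ P b)) ⟶ c.conj (𝟙_ C),
        (∀ s : T.obj (cokernel (relationMap c hT τ P b)) ⟶ c.conj (𝟙_ C),
          T.map (cokernel.π (relationMap c hT τ P b)) ≫ s =
              (boxTensorIso τ P (c.conj P)).hom ≫ c.pairing P ↔ s = r') ∧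
        ∃ χ : T.op ⋙ (linearYoneda k C).obj (c.conj (𝟙_ C)) ≅
            (linearYoneda k D).obj (cokernel (relationMap c hT τ P b)),
          χ.hom.app (op (cokernel (relationMap c hT τ P b))) r' =
            𝟙 (cokernel (relationMap c hT τ P b))) ∧
    ∃ R : D, Nonempty (T.op ⋙ (linearYoneda k C).obj (c.conj (𝟙_ C)) ≅
      (linearYoneda k D).obj R) :=
  mainTheorem4_general.{w, v, u, u', max u u'} hPF c box hbox T hT τ P hP
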